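/- For a permutation $\sigma=\sigma_1\cdots\sigma_N$ of $\{1,\dots,N\}$ put $\sigma_0=\sigma_{N+1}=0$, and let - $V(\sigma)$ be the number of valleys, i.e. of $1\le i\le N$ with $\sigma_{i-1}>\sigma_i<\sigma_{i+1}$; - $W(\sigma)$ be the number of exterior peaks, i.e. of $1\le i\le N$ with $\sigma_{i-1}<\sigma_i>\sigma_{i+1}$; - $\mathrm{rdd}(\sigma)$ be the number of right double descents, i.e. of $1<i\le N$ with $\sigma_{i-1}>\sigma_i>\sigma_{i+1}$; - $\mathrm{lda}(\sigma)$ be the number of left double ascents, i.e. of $1\le i<N$ with $\sigma_{i-1}<\sigma_i<\sigma_{i+1}$; - $\mathrm{LRmax}(\sigma)$ and $\mathrm{RLmax}(\sigma)$ be the numbers of left-to-right maxima and of right-to-left maxima of $\sigma$, i.e. of those $i$ with $\sigma_j<\sigma_i$ for all $j<i$ (respectively, all $j>i$) in $\{1,\dots,N\}$. For $n\ge 0$ define $$P_n(u_1,u_2,u_3,u_4|\alpha,\beta)=\sum_{\sigma\in\mathfrak S_{n+1}}u_1^{V(\sigma)}u_2^{W(\sigma)-1}u_3^{\mathrm{rdd}(\sigma)}u_4^{\mathrm{lda}(\sigma)}\alpha^{\mathrm{LRmax}(\sigma)-1}\beta^{\mathrm{RLmax}(\sigma)-1}.$$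 Let $u_1,u_2,u_3,u_4,\alpha,\beta$ be elements of a commutative $\mathbb Q$-algebra $R$ (for instance, indeterminates), and put $\Delta=(u_3+u_4)^2-4u_1u_2$. Then, as formal power series in $t$ over $R$, $$\sum_{n\ge 0}P_n(u_1,u_2,u_3,u_4|\alpha,\beta)\frac{t^n}{n!}=e^{\frac12(\beta-\alpha)(u_3-u_4)t}\left(\cosh\left(\tfrac t2\sqrt\Delta\right)-\frac{u_3+u_4}{\sqrt\Delta}\sinh\left(\tfrac t2\sqrt\Delta\right)\right)^{-(\alpha+\beta)}.$$ Here $f^{\gamma}=\exp(\gamma\log f)$ for a power series $f$ with constant term $1$. The identity holds for every choice of an invertible square root $\sqrt\Delta$ of $\Delta$ in $R$. It also holds with no assumption on $\Delta$ if $\cosh(\frac t2\sqrt\Delta)$ and $\frac1{\sqrt\Delta}\sinh(\frac t2\sqrt\Delta)$ are read as the series $\sum_{k\ge0}\frac{\Delta^k}{(2k)!}\left(\frac t2\right)^{2k}$ and $\sum_{k\ge0}\frac{\Delta^k}{(2k+1)!}\left(\frac t2\right)^{2k+1}$. -/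

import Mathlib

open PowerSeries

noncomputable section

namespace DescentStirling

/-! ### Permutation statistics

A permutation of `{1, …, N}` is an element of `Equiv.Perm (Fin N)`. -/

/-- The word `σ₁ σ₂ ⋯ σ_N` of a permutation of `{1, …, N}`, indexed by positions `1 ≤ i ≤ N` and with
letters in `{1, …, N}`, padded by `σ₀ = σ_{N+1} = 0`. -/
def word {N : ℕ} (σ : Equiv.Perm (Fin N)) (i : ℕ) : ℕ :=
  if h : 1 ≤ i ∧ i ≤ N then (σ ⟨i - 1, by omega⟩ : ℕ) + 1 else 0

/-- The number of valleys: `1 ≤ i ≤ N` with `σ_{i-1} > σ_i < σ_{i+1}`, where `σ₀ = σ_{N+1} = 0`. -/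
def valleys {N : ℕ} (σ : Equiv.Perm (Fin N)) : ℕ :=
  ((Finset.Icc 1 N).filter fun i => word σ (i - 1) > word σ i ∧ word σ i < word σ (i + 1)).card

/-- The number of exterior peaks: `1 ≤ i ≤ N` with `σ_{i-1} < σ_i > σ_{i+1}`,
where `σ₀ = σ_{N+1} = 0`. -/
def exteriorPeaks {N : ℕ} (σ : Equiv.Perm (Fin N)) : ℕ :=
  ((Finset.Icc 1 N).filter fun i => word σ (i - 1) < word σ i ∧ word σ i > word σ (i + 1)).card

/-- The number of right double descents: `1 < i ≤ N` with `σ_{i-1} > σ_i > σ_{i+1}`,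
where `σ_{N+1} = 0`. -/
def rightDoubleDescents {N : ℕ} (σ : Equiv.Perm (Fin N)) : ℕ :=
  ((Finset.Ioc 1 N).filter fun i => word σ (i - 1) > word σ i ∧ word σ i > word σ (i + 1)).card

/-- The number of left double ascents: `1 ≤ i < N` with `σ_{i-1} < σ_i < σ_{i+1}`,
where `σ₀ = 0`. -/
def leftDoubleAscents {N : ℕ} (σ : Equiv.Perm (Fin N)) : ℕ :=
  ((Finset.Ico 1 N).filter fun i => word σ (i - 1) < word σ i ∧ word σ i < word σ (i + 1)).card

/-- The number of left-to-right maxima: positions `i` with `σ_j < σ_i` for all `j < i`. -/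
def lrMax {N : ℕ} (σ : Equiv.Perm (Fin N)) : ℕ :=
  (Finset.univ.filter fun i : Fin N => ∀ j, j < i → σ j < σ i).card

/-- The number of right-to-left maxima: positions `i` with `σ_j < σ_i` for all `j > i`. -/
def rlMax {N : ℕ} (σ : Equiv.Perm (Fin N)) : ℕ :=
  (Finset.univ.filter fun i : Fin N => ∀ j, i < j → σ j < σ i).card

/-- The polynomial `P_n(u₁, u₂, u₃, u₄ | α, β)`, at arbitrary elements of a commutative ring.
A permutation of a nonempty set has at least one exterior peak, one left-to-right maximum and one
right-to-left maximum, so no subtraction in the exponents truncates. -/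
def P {R : Type*} [CommRing R] (n : ℕ) (u₁ u₂ u₃ u₄ α β : R) : R :=
  ∑ σ : Equiv.Perm (Fin (n + 1)),
    u₁ ^ valleys σ * u₂ ^ (exteriorPeaks σ - 1) * u₃ ^ rightDoubleDescents σ *
      u₄ ^ leftDoubleAscents σ * α ^ (lrMax σ - 1) * β ^ (rlMax σ - 1)

/-! ### Formal power series in one variable `t` over a commutative `ℚ`-algebra -/

section Series

variable {R : Type*} [CommRing R] [Algebra ℚ R]

/-- The exponential generating function `∑ a_n tⁿ / n!`. -/
def egf (a : ℕ → R) : R⟦X⟧ :=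
  PowerSeries.mk fun n => algebraMap ℚ R (1 / (n.factorial : ℚ)) * a n

/-- The series `e^{c t}`. -/
def expSeries (c : R) : R⟦X⟧ := rescale c (PowerSeries.exp R)

/-- The series `cosh (c t) = (e^{c t} + e^{-c t}) / 2`. -/
def coshSeries (c : R) : R⟦X⟧ := (1 / 2 : ℚ) • (expSeries c + expSeries (-c))

/-- The series `sinh (c t) = (e^{c t} - e^{-c t}) / 2`. -/
def sinhSeries (c : R) : R⟦X⟧ := (1 / 2 : ℚ) • (expSeries c - expSeries (-c))

/-- The power `f ^ γ = exp (γ log f)` of a series `f` with constant term `1`, for any scalar `γ`. -/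
def seriesPow (f : R⟦X⟧) (γ : R) : R⟦X⟧ :=
  (PowerSeries.exp R).subst (PowerSeries.C γ * PowerSeries.logOf f)

/-- The series `cosh ((t / 2) √d) = ∑ₖ dᵏ (t / 2)^{2k} / (2k)!`, which involves no square root. -/
def coshSqrtSeries (d : R) : R⟦X⟧ :=
  PowerSeries.mk fun n =>
    if Even n then algebraMap ℚ R (1 / (2 ^ n * (n.factorial : ℚ))) * d ^ (n / 2) else 0

/-- The series `sinh ((t / 2) √d) / √d = ∑ₖ dᵏ (t / 2)^{2k+1} / (2k+1)!`, which involves no square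
root and no division by `d`. -/
def sinhDivSqrtSeries (d : R) : R⟦X⟧ :=
  PowerSeries.mk fun n =>
    if Odd n then algebraMap ℚ R (1 / (2 ^ n * (n.factorial : ℚ))) * d ^ (n / 2) else 0

end Series

end DescentStirling

end

/-!
The exponential generating function is determined by a first-order partial differential equation
that comes from inserting a new smallest letter into a permutation.

Raise all letters of a permutation by one and insert the letter `1` into one of the gaps of its
word. In front it becomes a left double ascent and a left-to-right maximum, at the end a right
double descent and a right-to-left maximum, and no other letter changes its type. In an inner gap it
becomes a valley, no maximum is gained or lost, and only the smaller neighbour changes type: a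
valley becomes a double descent or a double ascent (according to the side), and a double ascent or
double descent becomes a peak. Hence, with the derivation `D` given by
`D u₁ = u₁ (u₃ + u₄)`, `D u₃ = D u₄ = u₁ u₂` and `D u₂ = D α = D β = 0`,
`P_{n+1} = (α u₄ + β u₃) P_n + D P_n` (`sum_wordWeight_insertOne`, and `mul_P_succ` up to the factor
`u₂ α β`), and the generating function is the only solution of
`∂H/∂t = (α u₄ + β u₃) H + D H` with constant term `1` (`egf_eq_of_derivative_eq`).

The right-hand side solves this equation (`egf_eq_of_recurrence`). Indeed `D` kills `Δ` and
`u₃ - u₄`, while `D (u₃ + u₄) = 2 u₁ u₂`, so `f = cosh (t √Δ / 2) - (u₃ + u₄) sinh (t √Δ / 2) / √Δ`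
satisfies `∂f/∂t - D f = -(u₃ + u₄) f / 2`; the chain rule for `f ^ γ` with respect to both `∂/∂t`
(`mul_derivative_seriesPow`) and `D` (`mul_coeffwise_seriesPow`) gives the rest.

The derivation `D` need not exist on an arbitrary `ℚ`-algebra. The argument is therefore carried out
for indeterminate parameters (`egf_P_universal`), and the identity is then specialized (`egf_P`).
-/

namespace DescentStirling

/-! ### Linear differential equations for formal power series -/

section Series

variable {A : Type*} [CommRing A] [Algebra ℚ A]

lemma eq_zero_of_natCast_succ_mul {a : A} (n : ℕ) (h : a * ((n : A) + 1) = 0) : a = 0 := by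
  have h1 : ((n : A) + 1) * algebraMap ℚ A (1 / ((n : ℚ) + 1)) = 1 := by
    have : ((n : A) + 1) = algebraMap ℚ A ((n : ℚ) + 1) := by simp
    rw [this, ← map_mul, mul_one_div_cancel (by positivity), map_one]
  linear_combination algebraMap ℚ A (1 / ((n : ℚ) + 1)) * h - a * h1

lemma isUnit_of_constantCoeff_eq_one {A : Type*} [CommRing A] {f : A⟦X⟧}
    (hf : constantCoeff f = 1) : IsUnit f :=
  isUnit_iff_constantCoeff.2 (hf ▸ isUnit_one)

/-- A homogeneous linear first-order equation `f Z' = c Z` with invertible leading coefficient has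
only the zero solution with zero constant term. -/
lemma eq_zero_of_mul_derivative_eq {f c Z : A⟦X⟧} (hf : constantCoeff f = 1)
    (hZ : constantCoeff Z = 0) (h : f * d⁄dX A Z = c * Z) : Z = 0 := by
  obtain ⟨g, hg⟩ := (isUnit_of_constantCoeff_eq_one hf).exists_left_inv
  have h' : d⁄dX A Z = (g * c) * Z := by
    linear_combination g * h - d⁄dX A Z * hg
  ext n
  induction n using Nat.strong_induction_on with
  | _ n ih =>
    cases n with
    | zero => simpa using hZ
    | succ n =>
      refine eq_zero_of_natCast_succ_mul n ?_
      rw [← coeff_derivative, h', coeff_mul]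
      refine Finset.sum_eq_zero fun x hx => ?_
      rw [ih x.2 (by have := Finset.HasAntidiagonal.mem_antidiagonal.1 hx; omega), map_zero, mul_zero]

lemma mul_derivative_logOf {f : A⟦X⟧} (hf : constantCoeff f = 1) :
    f * d⁄dX A (logOf f) = d⁄dX A f := by
  have hs : HasSubst (f - 1) := HasSubst.of_constantCoeff_zero' (by simp [hf])
  have h1 : d⁄dX A (log A) * (1 + X) = 1 := by
    rw [deriv_log]
    ext n
    cases n with
    | zero => simp [mul_add]
    | succ n => simp [mul_add, coeff_succ_mul_X, pow_succ, coeff_one]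
  have h2 := congrArg (subst (f - 1)) h1
  rw [subst_mul hs, subst_add hs, subst_X hs, ← coe_substAlgHom hs, map_one, coe_substAlgHom hs]
    at h2
  rw [logOf_eq, derivative_subst hs, map_sub, derivative_one, sub_zero]
  linear_combination d⁄dX A f * h2

lemma hasSubst_C_mul_logOf {f : A⟦X⟧} (hf : constantCoeff f = 1) (γ : A) :
    HasSubst (C γ * logOf f) :=
  HasSubst.of_constantCoeff_zero' (by simp [constantCoeff_logOf hf])

lemma constantCoeff_seriesPow {f : A⟦X⟧} (hf : constantCoeff f = 1) (γ : A) :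
    constantCoeff (seriesPow f γ) = 1 := by
  have hs := hasSubst_C_mul_logOf hf γ
  have h0 : MvPowerSeries.constantCoeff (C γ * logOf f : A⟦X⟧) = 0 := by
    rw [← constantCoeff_eq]; simp [constantCoeff_logOf hf]
  have h := constantCoeff_subst_eq_zero h0 (exp A - 1) (by simp)
  rw [subst_sub hs, ← coe_substAlgHom hs, map_one, coe_substAlgHom hs, map_sub, map_one,
    sub_eq_zero] at h
  exact h

lemma mul_derivative_seriesPow {f : A⟦X⟧} (hf : constantCoeff f = 1) (γ : A) :
    f * d⁄dX A (seriesPow f γ) = C γ * d⁄dX A f * seriesPow f γ := by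
  rw [seriesPow, derivative_subst (hasSubst_C_mul_logOf hf γ), derivative_exp, Derivation.leibniz,
    derivative_C, smul_zero, add_zero, smul_eq_mul]
  linear_combination (C γ * (exp A).subst (C γ * logOf f)) * mul_derivative_logOf hf

lemma constantCoeff_expSeries (c : A) : constantCoeff (expSeries c) = 1 := by
  rw [← coeff_zero_eq_constantCoeff_apply, expSeries, coeff_rescale]
  simp

lemma derivative_expSeries (c : A) : d⁄dX A (expSeries c) = C c * expSeries c := by
  ext n
  have h := congrArg (coeff n) (derivative_exp A)
  rw [coeff_derivative] at h
  rw [coeff_derivative, coeff_C_mul, expSeries, coeff_rescale, coeff_rescale, pow_succ]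
  linear_combination c ^ n * c * h

/-! ### Hyperbolic series in `√d` -/

lemma constantCoeff_coshSqrtSeries (d : A) : constantCoeff (coshSqrtSeries d) = 1 := by
  rw [← coeff_zero_eq_constantCoeff_apply, coshSqrtSeries, coeff_mk]
  simp

lemma constantCoeff_sinhDivSqrtSeries (d : A) : constantCoeff (sinhDivSqrtSeries d) = 0 := by
  rw [← coeff_zero_eq_constantCoeff_apply, sinhDivSqrtSeries, coeff_mk]
  simp

lemma algebraMap_mul_natCast_succ (n : ℕ) :
    algebraMap ℚ A (1 / (2 ^ (n + 1) * ((n + 1).factorial : ℚ))) * ((n : A) + 1) =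
      algebraMap ℚ A (1 / 2) * algebraMap ℚ A (1 / (2 ^ n * (n.factorial : ℚ))) := by
  have : ((n : A) + 1) = algebraMap ℚ A ((n : ℚ) + 1) := by simp
  rw [this, ← map_mul, ← map_mul]
  congr 1
  have := Nat.factorial_pos n
  rw [Nat.factorial_succ, pow_succ]
  push_cast
  field_simp

lemma derivative_coshSqrtSeries (d : A) :
    d⁄dX A (coshSqrtSeries d) = C (algebraMap ℚ A (1 / 2) * d) * sinhDivSqrtSeries d := by
  ext n
  rw [coeff_derivative, coeff_C_mul, coshSqrtSeries, sinhDivSqrtSeries, coeff_mk, coeff_mk]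
  rcases Nat.even_or_odd' n with ⟨k, rfl | rfl⟩
  · simp
  · have h := algebraMap_mul_natCast_succ (A := A) (2 * k + 1)
    have e1 : (2 * k + 1 + 1) / 2 = k + 1 := by omega
    have e2 : (2 * k + 1) / 2 = k := by omega
    rw [if_pos (by simp [parity_simps]), if_pos (by simp), e1, e2]
    linear_combination d ^ (k + 1) * h

lemma derivative_sinhDivSqrtSeries (d : A) :
    d⁄dX A (sinhDivSqrtSeries d) = C (algebraMap ℚ A (1 / 2)) * coshSqrtSeries d := by
  ext n
  rw [coeff_derivative, coeff_C_mul, coshSqrtSeries, sinhDivSqrtSeries, coeff_mk, coeff_mk]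
  rcases Nat.even_or_odd' n with ⟨k, rfl | rfl⟩
  · have h := algebraMap_mul_natCast_succ (A := A) (2 * k)
    have e1 : (2 * k + 1) / 2 = k := by omega
    have e2 : (2 * k) / 2 = k := by omega
    rw [if_pos (by simp), if_pos (by simp), e1, e2]
    linear_combination d ^ k * h
  · simp [parity_simps]

lemma coeff_expSeries (c : A) (n : ℕ) :
    coeff n (expSeries c) = c ^ n * algebraMap ℚ A (1 / (n.factorial : ℚ)) := by
  rw [expSeries, coeff_rescale, coeff_exp]

lemma coeff_expSeries_half (s : A) (n : ℕ) :
    coeff n (expSeries ((1 / 2 : ℚ) • s)) =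
      algebraMap ℚ A (1 / (2 ^ n * (n.factorial : ℚ))) * s ^ n := by
  have : (1 / (2 ^ n * (n.factorial : ℚ))) = (1 / 2) ^ n * (1 / (n.factorial : ℚ)) := by
    rw [one_div_pow, one_div_mul_one_div]
  rw [coeff_expSeries, this, map_mul, map_pow, Algebra.smul_def, mul_pow]
  ring

lemma half_smul_add_self (a : A) : (1 / 2 : ℚ) • (a + a) = a := by
  rw [← two_smul ℚ a, smul_smul]
  norm_num

lemma coshSeries_half (s : A) : coshSeries ((1 / 2 : ℚ) • s) = coshSqrtSeries (s ^ 2) := by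
  ext n
  rw [coshSeries, coshSqrtSeries, coeff_mk, coeff_smul, map_add, ← smul_neg,
    coeff_expSeries_half, coeff_expSeries_half]
  split_ifs with hn
  · rw [hn.neg_pow, half_smul_add_self, ← pow_mul, Nat.mul_div_cancel' hn.two_dvd]
  · rw [(Nat.not_even_iff_odd.1 hn).neg_pow]
    simp

lemma sinhSeries_half (s : A) :
    sinhSeries ((1 / 2 : ℚ) • s) = C s * sinhDivSqrtSeries (s ^ 2) := by
  ext n
  rw [sinhSeries, sinhDivSqrtSeries, coeff_C_mul, coeff_mk, coeff_smul, map_sub, ← smul_neg,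
    coeff_expSeries_half, coeff_expSeries_half]
  split_ifs with hn
  · rw [hn.neg_pow, mul_neg, sub_neg_eq_add, half_smul_add_self, ← pow_mul, mul_left_comm,
      ← pow_succ', Nat.two_mul_div_two_add_one_of_odd hn]
  · rw [(Nat.not_odd_iff_even.1 hn).neg_pow]
    simp

/-! ### Coefficientwise derivations -/

/-- The derivation of `A⟦X⟧` that applies a derivation of `A` to every coefficient. -/
noncomputable def coeffwise (D : Derivation ℚ A A) : Derivation ℚ A⟦X⟧ A⟦X⟧ :=
  Derivation.mk'
    { toFun := fun f => PowerSeries.mk fun n => D (coeff n f)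
      map_add' := fun f g => by ext n; simp
      map_smul' := fun q f => by ext n; simp }
    fun f g => by
      ext n
      simp only [LinearMap.coe_mk, AddHom.coe_mk, coeff_mk, smul_eq_mul, map_add, coeff_mul,
        map_sum, Derivation.leibniz, Finset.sum_add_distrib]
      congr 1
      rw [← Finset.Nat.sum_antidiagonal_swap]
      rfl

variable (D : Derivation ℚ A A)

@[simp] lemma coeff_coeffwise (f : A⟦X⟧) (n : ℕ) : coeff n (coeffwise D f) = D (coeff n f) :=
  coeff_mk n fun n => D (coeff n f)

lemma coeffwise_C (a : A) : coeffwise D (C a) = C (D a) := by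
  ext n
  simp only [coeff_coeffwise, coeff_C]
  split_ifs <;> simp

lemma coeffwise_derivative (f : A⟦X⟧) :
    coeffwise D (d⁄dX A f) = d⁄dX A (coeffwise D f) := by
  ext n
  have : D ((n : A) + 1) = 0 := by simp
  simp [coeff_derivative, this, mul_comm]

lemma coeffwise_coshSqrtSeries {d : A} (hd : D d = 0) : coeffwise D (coshSqrtSeries d) = 0 := by
  ext n
  rw [coeff_coeffwise, coshSqrtSeries, coeff_mk]
  split_ifs <;> simp [hd, Derivation.leibniz_pow]

lemma coeffwise_sinhDivSqrtSeries {d : A} (hd : D d = 0) :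
    coeffwise D (sinhDivSqrtSeries d) = 0 := by
  ext n
  rw [coeff_coeffwise, sinhDivSqrtSeries, coeff_mk]
  split_ifs <;> simp [hd, Derivation.leibniz_pow]

lemma coeffwise_expSeries {c : A} (hc : D c = 0) : coeffwise D (expSeries c) = 0 := by
  ext n
  rw [coeff_coeffwise, coeff_expSeries]
  simp [hc, Derivation.leibniz_pow]

/-- The chain rule for a coefficientwise derivation applied to `f ^ γ`. Both sides solve the same
first-order linear equation in the series variable, so they agree. -/
lemma mul_coeffwise_seriesPow {f : A⟦X⟧} (hf : constantCoeff f = 1) {γ : A} (hγ : D γ = 0) :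
    f * coeffwise D (seriesPow f γ) = C γ * coeffwise D f * seriesPow f γ := by
  rw [← sub_eq_zero]
  have hy := mul_derivative_seriesPow hf γ
  have hDy := congrArg (coeffwise D) hy
  simp only [Derivation.leibniz, smul_eq_mul, coeffwise_derivative, coeffwise_C, hγ, map_zero,
    mul_zero, add_zero] at hDy
  refine eq_zero_of_mul_derivative_eq (c := (1 + C γ) * d⁄dX A f) hf ?_ ?_
  · have h1 : constantCoeff (coeffwise D f) = 0 := by
      rw [← coeff_zero_eq_constantCoeff_apply, coeff_coeffwise, coeff_zero_eq_constantCoeff_apply,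
        hf, Derivation.map_one_eq_zero]
    have h2 : constantCoeff (coeffwise D (seriesPow f γ)) = 0 := by
      rw [← coeff_zero_eq_constantCoeff_apply, coeff_coeffwise, coeff_zero_eq_constantCoeff_apply,
        constantCoeff_seriesPow hf, Derivation.map_one_eq_zero]
    simp [h1, h2]
  · simp only [map_sub, Derivation.leibniz, smul_eq_mul, derivative_C]
    linear_combination f * hDy - (1 + C γ) * coeffwise D f * hy

/-! ### The partial differential equation of the generating function -/

/-- A series with constant term `1` solving `∂H/∂t = c H + D H` is the exponential generating
function of the sequence obtained by iterating `c + D` on `1`. -/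
lemma egf_eq_of_derivative_eq {Q : ℕ → A} {c : A} {H : A⟦X⟧} (hQ₀ : Q 0 = 1)
    (hQ : ∀ n, Q (n + 1) = c * Q n + D (Q n)) (hH₀ : constantCoeff H = 1)
    (hH : d⁄dX A H = C c * H + coeffwise D H) : egf Q = H := by
  ext n
  rw [egf, coeff_mk]
  induction n with
  | zero => simp [hQ₀, hH₀]
  | succ n ih =>
    have h := congrArg (coeff n) hH
    rw [coeff_derivative, map_add, coeff_C_mul, coeff_coeffwise, ← ih] at h
    simp only [Derivation.leibniz, Derivation.map_algebraMap, smul_eq_mul, mul_zero,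
      add_zero] at h
    have e : algebraMap ℚ A (1 / ((n + 1).factorial : ℚ)) * ((n : A) + 1) =
        algebraMap ℚ A (1 / (n.factorial : ℚ)) := by
      have : ((n : A) + 1) = algebraMap ℚ A ((n : ℚ) + 1) := by simp
      rw [this, ← map_mul]
      congr 1
      have := Nat.factorial_pos n
      rw [Nat.factorial_succ]
      push_cast
      field_simp
    rw [← sub_eq_zero]
    refine eq_zero_of_natCast_succ_mul n ?_
    rw [hQ]
    linear_combination (c * Q n + D (Q n)) * e - h

/-- The series `cosh (t √Δ / 2) - (u₃ + u₄) sinh (t √Δ / 2) / √Δ`, where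
`Δ = (u₃ + u₄)² - 4 u₁ u₂`. -/
noncomputable def base (u₁ u₂ u₃ u₄ : A) : A⟦X⟧ :=
  coshSqrtSeries ((u₃ + u₄) ^ 2 - 4 * u₁ * u₂) -
    C (u₃ + u₄) * sinhDivSqrtSeries ((u₃ + u₄) ^ 2 - 4 * u₁ * u₂)

lemma constantCoeff_base (u₁ u₂ u₃ u₄ : A) : constantCoeff (base u₁ u₂ u₃ u₄) = 1 := by
  simp [base, constantCoeff_coshSqrtSeries, constantCoeff_sinhDivSqrtSeries]

/-- The right-hand side of the identity solves the differential equation that encodes the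
recurrence `Q (n + 1) = (α u₄ + β u₃) Q n + D (Q n)`. -/
theorem egf_eq_of_recurrence {u₁ u₂ u₃ u₄ α β : A} (h₁ : D u₁ = u₁ * (u₃ + u₄)) (h₂ : D u₂ = 0)
    (h₃ : D u₃ = u₁ * u₂) (h₄ : D u₄ = u₁ * u₂) (hα : D α = 0) (hβ : D β = 0) {Q : ℕ → A}
    (hQ₀ : Q 0 = 1) (hQ : ∀ n, Q (n + 1) = (α * u₄ + β * u₃) * Q n + D (Q n)) :
    egf Q = expSeries ((1 / 2 : ℚ) • ((β - α) * (u₃ - u₄))) *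
      seriesPow (base u₁ u₂ u₃ u₄) (-(α + β)) := by
  have hf := constantCoeff_base u₁ u₂ u₃ u₄
  refine egf_eq_of_derivative_eq D hQ₀ hQ ?_ ?_
  · rw [map_mul, constantCoeff_expSeries, constantCoeff_seriesPow hf, one_mul]
  have he : D ((1 / 2 : ℚ) • ((β - α) * (u₃ - u₄))) = 0 := by
    simp [hα, hβ, h₃, h₄]
  have hΔ : D ((u₃ + u₄) ^ 2 - 4 * u₁ * u₂) = 0 := by
    have h4 : D (4 : A) = 0 := D.map_natCast 4
    simp only [map_sub, Derivation.leibniz_pow, Derivation.leibniz, map_add, h₁, h₂, h₃, h₄, h4,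
      smul_eq_mul, nsmul_eq_mul]
    push_cast
    ring
  have h2 : (2 : A⟦X⟧) * C (algebraMap ℚ A (1 / 2)) = 1 := by
    have : (2 : A⟦X⟧) = C (algebraMap ℚ A 2) := by rw [map_ofNat, map_ofNat]
    rw [this, ← map_mul, ← map_mul]
    norm_num
  -- The transport equation of the base: `∂f/∂t - D f = -(u₃ + u₄) f / 2`.
  have hbase : d⁄dX A (base u₁ u₂ u₃ u₄) - coeffwise D (base u₁ u₂ u₃ u₄) =
      -(C (algebraMap ℚ A (1 / 2)) * C (u₃ + u₄)) * base u₁ u₂ u₃ u₄ := by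
    simp only [base, map_sub, Derivation.leibniz, derivative_C, coeffwise_C,
      coeffwise_coshSqrtSeries D hΔ, coeffwise_sinhDivSqrtSeries D hΔ, derivative_coshSqrtSeries,
      derivative_sinhDivSqrtSeries, smul_eq_mul, map_add, map_mul, map_pow, h₃, h₄, map_ofNat]
    linear_combination (-C u₁ * C u₂ * 2 *
      sinhDivSqrtSeries ((u₃ + u₄) ^ 2 - 4 * u₁ * u₂)) * h2
  have hY := mul_derivative_seriesPow hf (-(α + β))
  have hDY := mul_coeffwise_seriesPow D hf (γ := -(α + β)) (by simp [hα, hβ])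
  refine (isUnit_of_constantCoeff_eq_one hf).mul_left_cancel ?_
  set f := base u₁ u₂ u₃ u₄
  set Y := seriesPow f (-(α + β))
  simp only [Derivation.leibniz, derivative_expSeries, coeffwise_expSeries D he, smul_eq_mul]
  set E := expSeries ((1 / 2 : ℚ) • ((β - α) * (u₃ - u₄)))
  rw [Algebra.smul_def]
  simp only [map_mul, map_sub, map_add, map_neg] at hY hDY hbase ⊢
  linear_combination E * hY - E * hDY - E * Y * (C α + C β) * hbase +
    E * Y * f * (C α * C u₄ + C β * C u₃) * h2

end Series

/-! ### Words and their weights -/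

section Words

variable {A : Type*} [CommRing A]

/-- The weight of a letter `b` with neighbours `a` and `c` in a word: `u₁` for a valley, `u₂` for a
peak, `u₃` for a double descent and `u₄` for a double ascent. -/
def letterWeight (u₁ u₂ u₃ u₄ : A) (a b c : ℕ) : A :=
  (if a > b ∧ b < c then u₁ else 1) * (if a < b ∧ b > c then u₂ else 1) *
    (if a > b ∧ b > c then u₃ else 1) * (if a < b ∧ b < c then u₄ else 1)

/-- The product of the weights of the letters `w 1, …, w N`. -/
def wordWeight (u₁ u₂ u₃ u₄ : A) (w : ℕ → ℕ) (N : ℕ) : A :=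
  ∏ i ∈ Finset.range N, letterWeight u₁ u₂ u₃ u₄ (w i) (w (i + 1)) (w (i + 2))

/-- Raising a letter by one; the padding `0` stays. -/
def raise (x : ℕ) : ℕ := if x = 0 then 0 else x + 1

/-- The word obtained by raising all letters of `w` by one and inserting the letter `1` immediately
after position `p`. -/
def insertOne (w : ℕ → ℕ) (p : ℕ) (i : ℕ) : ℕ :=
  if i ≤ p then raise (w i) else if i = p + 1 then 1 else raise (w (i - 1))

lemma raise_lt_raise {x y : ℕ} : raise x < raise y ↔ x < y := by
  unfold raise; split_ifs <;> omega

lemma one_lt_raise {x : ℕ} : 1 < raise x ↔ 0 < x := by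
  unfold raise; split_ifs <;> omega

lemma raise_lt_one {x : ℕ} : raise x < 1 ↔ x = 0 := by
  unfold raise; split_ifs <;> omega

variable {u₁ u₂ u₃ u₄ : A}

lemma letterWeight_raise (a b c : ℕ) :
    letterWeight u₁ u₂ u₃ u₄ (raise a) (raise b) (raise c) = letterWeight u₁ u₂ u₃ u₄ a b c := by
  simp only [letterWeight, gt_iff_lt, raise_lt_raise]

lemma insertOne_of_le {w : ℕ → ℕ} {p i : ℕ} (h : i ≤ p) : insertOne w p i = raise (w i) :=
  if_pos h

lemma insertOne_self (w : ℕ → ℕ) (p : ℕ) : insertOne w p (p + 1) = 1 := by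
  simp [insertOne]

lemma insertOne_of_gt {w : ℕ → ℕ} {p i : ℕ} (h : p + 1 < i + 1) :
    insertOne w p (i + 1) = raise (w i) := by
  rw [insertOne, if_neg (by omega), if_neg (by omega), Nat.add_sub_cancel]

/-- Inserting the new smallest letter at the front creates a double ascent and changes nothing
else. -/
lemma wordWeight_insertOne_zero {w : ℕ → ℕ} {N : ℕ} (h₀ : w 0 = 0) (h₁ : 0 < w 1) :
    wordWeight u₁ u₂ u₃ u₄ (insertOne w 0) (N + 1 + 1) =
      u₄ * wordWeight u₁ u₂ u₃ u₄ w (N + 1) := by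
  simp only [wordWeight]
  rw [Finset.prod_range_succ', Finset.prod_range_succ', Finset.prod_range_succ' _ N]
  have e : ∀ i, insertOne w 0 (i + 2) = raise (w (i + 1)) := fun i => insertOne_of_gt (by omega)
  have e0 : insertOne w 0 0 = 0 := by rw [insertOne_of_le le_rfl, h₀]; rfl
  have e1 : insertOne w 0 1 = 1 := insertOne_self w 0
  have e2 : letterWeight u₁ u₂ u₃ u₄ 1 (raise (w 1)) (raise (w 2)) =
      letterWeight u₁ u₂ u₃ u₄ 0 (w 1) (w 2) := by
    have : ¬ raise (w 1) < 1 := by rw [raise_lt_one]; omega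
    simp [letterWeight, raise_lt_raise, one_lt_raise, h₁, this]
  have e3 : letterWeight u₁ u₂ u₃ u₄ 0 1 (raise (w 1)) = u₄ := by
    have : ¬ raise (w 1) < 1 := by rw [raise_lt_one]; omega
    simp [letterWeight, one_lt_raise, h₁, this]
  simp only [zero_add, e0, e1, e, Nat.reduceAdd, add_assoc, letterWeight_raise, h₀, e2, e3]
  ring

/-- Inserting the new smallest letter at the end creates a double descent and changes nothing
else. -/
lemma wordWeight_insertOne_last {w : ℕ → ℕ} {N : ℕ} (h₀ : w (N + 2) = 0) (h₁ : 0 < w (N + 1)) :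
    wordWeight u₁ u₂ u₃ u₄ (insertOne w (N + 1)) (N + 1 + 1) =
      u₃ * wordWeight u₁ u₂ u₃ u₄ w (N + 1) := by
  simp only [wordWeight]
  rw [Finset.prod_range_succ, Finset.prod_range_succ, Finset.prod_range_succ _ N]
  have hn : ¬ raise (w (N + 1)) < 1 := by rw [raise_lt_one]; omega
  have e0 : insertOne w (N + 1) (N + 2) = 1 := insertOne_self w (N + 1)
  have e1 : insertOne w (N + 1) (N + 1 + 2) = 0 := by
    rw [insertOne_of_gt (by omega), h₀]; rfl
  have e2 : insertOne w (N + 1) (N + 1) = raise (w (N + 1)) := insertOne_of_le le_rfl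
  have e3 : insertOne w (N + 1) N = raise (w N) := insertOne_of_le (by omega)
  have e4 : letterWeight u₁ u₂ u₃ u₄ (raise (w N)) (raise (w (N + 1))) 1 =
      letterWeight u₁ u₂ u₃ u₄ (w N) (w (N + 1)) 0 := by
    simp [letterWeight, raise_lt_raise, one_lt_raise, h₁, hn]
  have e5 : letterWeight u₁ u₂ u₃ u₄ (raise (w (N + 1))) 1 0 = u₃ := by
    simp [letterWeight, one_lt_raise, h₁, hn]
  have e6 : ∀ i ∈ Finset.range N, letterWeight u₁ u₂ u₃ u₄ (insertOne w (N + 1) i)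
      (insertOne w (N + 1) (i + 1)) (insertOne w (N + 1) (i + 2)) =
      letterWeight u₁ u₂ u₃ u₄ (w i) (w (i + 1)) (w (i + 2)) := fun i hi => by
    have := Finset.mem_range.1 hi
    rw [insertOne_of_le (by omega), insertOne_of_le (by omega), insertOne_of_le (by omega),
      letterWeight_raise]
  rw [Finset.prod_congr rfl e6, e0, e1, e2, e3, e4, e5, h₀]
  ring

/-- The part of the derivative of the weight of `b` that accounts for inserting a new smallest
letter immediately after `b`, when `b` is followed by an ascent: the new letter is a valley, and `b`
becomes followed by a descent. -/
def rightPart (u₁ u₂ u₃ u₄ : A) (a b c : ℕ) : A :=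
  if b < c then u₁ * letterWeight u₁ u₂ u₃ u₄ a b 0 else 0

/-- The part of the derivative of the weight of `b` that accounts for inserting a new smallest
letter immediately before `b`, when `b` is preceded by a descent: the new letter is a valley, and
`b` becomes preceded by an ascent. -/
def leftPart (u₁ u₂ u₃ u₄ : A) (a b c : ℕ) : A :=
  if b < a then u₁ * letterWeight u₁ u₂ u₃ u₄ 0 b c else 0

lemma derivation_letterWeight [Algebra ℚ A] {D : Derivation ℚ A A} (h₁ : D u₁ = u₁ * (u₃ + u₄))
    (h₂ : D u₂ = 0) (h₃ : D u₃ = u₁ * u₂) (h₄ : D u₄ = u₁ * u₂) {a b c : ℕ} (hb : 0 < b)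
    (hab : a ≠ b) (hbc : b ≠ c) :
    D (letterWeight u₁ u₂ u₃ u₄ a b c) =
      rightPart u₁ u₂ u₃ u₄ a b c + leftPart u₁ u₂ u₃ u₄ a b c := by
  rcases lt_or_gt_of_ne hab with h | h <;> rcases lt_or_gt_of_ne hbc with h' | h' <;>
    simp [letterWeight, rightPart, leftPart, h, h', h.not_gt, h'.not_gt, hb, h₁, h₂, h₃, h₄,
      mul_add]

lemma prod_erase_range (f : ℕ → A) (a b : ℕ) :
    ∏ i ∈ (Finset.range (a + 1 + b)).erase a, f i =
      (∏ i ∈ Finset.range a, f i) * ∏ i ∈ Finset.range b, f (a + 1 + i) := by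
  have h : (Finset.range (a + 1 + b)).erase a =
      Finset.range a ∪ (Finset.range b).map (addLeftEmbedding (a + 1)) := by
    ext i
    simp only [Finset.mem_erase, Finset.mem_range, Finset.mem_union, Finset.mem_map,
      addLeftEmbedding_apply]
    constructor
    · intro hi
      by_cases h : i < a
      · exact Or.inl h
      · exact Or.inr ⟨i - (a + 1), by omega, by omega⟩
    · rintro (hi | ⟨j, hj, rfl⟩) <;> omega
  rw [h, Finset.prod_union, Finset.prod_map]
  · rfl
  · rw [Finset.disjoint_left]
    simp only [Finset.mem_range, Finset.mem_map, addLeftEmbedding_apply]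
    rintro i hi ⟨j, hj, rfl⟩
    omega

/-- Inserting a new smallest letter between the adjacent letters `w (a + 1)` and `w (a + 2)` creates
a valley, and changes the type of the smaller of the two only. -/
lemma wordWeight_insertOne_interior {w : ℕ → ℕ} {a b : ℕ} (h₁ : 0 < w (a + 1))
    (h₂ : 0 < w (a + 2)) (h : w (a + 1) ≠ w (a + 2)) :
    wordWeight u₁ u₂ u₃ u₄ (insertOne w (a + 1)) (a + 1 + 1 + b + 1) =
      rightPart u₁ u₂ u₃ u₄ (w a) (w (a + 1)) (w (a + 2)) *
          ∏ i ∈ (Finset.range (a + 1 + 1 + b)).erase a,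
            letterWeight u₁ u₂ u₃ u₄ (w i) (w (i + 1)) (w (i + 2)) +
        leftPart u₁ u₂ u₃ u₄ (w (a + 1)) (w (a + 2)) (w (a + 3)) *
          ∏ i ∈ (Finset.range (a + 1 + 1 + b)).erase (a + 1),
            letterWeight u₁ u₂ u₃ u₄ (w i) (w (i + 1)) (w (i + 2)) := by
  rw [prod_erase_range _ (a + 1) b, add_assoc (a + 1) 1 b, prod_erase_range _ a (1 + b),
    Finset.prod_range_succ, add_comm 1 b, Finset.prod_range_succ', wordWeight,
    show a + 1 + (b + 1) + 1 = a + 1 + 1 + 1 + b by ring, Finset.prod_range_add,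
    Finset.prod_range_succ, Finset.prod_range_succ, Finset.prod_range_succ]
  have hn₁ : ¬ raise (w (a + 1)) < 1 := by rw [raise_lt_one]; omega
  have hn₂ : ¬ raise (w (a + 2)) < 1 := by rw [raise_lt_one]; omega
  have e0 : insertOne w (a + 1) a = raise (w a) := insertOne_of_le (by omega)
  have e1 : insertOne w (a + 1) (a + 1) = raise (w (a + 1)) := insertOne_of_le le_rfl
  have e2 : insertOne w (a + 1) (a + 2) = 1 := insertOne_self w (a + 1)
  have e3 : insertOne w (a + 1) (a + 3) = raise (w (a + 2)) := insertOne_of_gt (by omega)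
  have e4 : insertOne w (a + 1) (a + 4) = raise (w (a + 3)) := insertOne_of_gt (by omega)
  have f1 : letterWeight u₁ u₂ u₃ u₄ (raise (w a)) (raise (w (a + 1))) 1 =
      letterWeight u₁ u₂ u₃ u₄ (w a) (w (a + 1)) 0 := by
    simp [letterWeight, raise_lt_raise, one_lt_raise, h₁, hn₁]
  have f2 : letterWeight u₁ u₂ u₃ u₄ (raise (w (a + 1))) 1 (raise (w (a + 2))) = u₁ := by
    simp [letterWeight, one_lt_raise, h₁, hn₁, h₂, hn₂]
  have f3 : letterWeight u₁ u₂ u₃ u₄ 1 (raise (w (a + 2))) (raise (w (a + 3))) =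
      letterWeight u₁ u₂ u₃ u₄ 0 (w (a + 2)) (w (a + 3)) := by
    simp [letterWeight, raise_lt_raise, one_lt_raise, h₂, hn₂]
  have e5 : ∀ i ∈ Finset.range a, letterWeight u₁ u₂ u₃ u₄ (insertOne w (a + 1) i)
      (insertOne w (a + 1) (i + 1)) (insertOne w (a + 1) (i + 2)) =
      letterWeight u₁ u₂ u₃ u₄ (w i) (w (i + 1)) (w (i + 2)) := fun i hi => by
    have := Finset.mem_range.1 hi
    rw [insertOne_of_le (by omega), insertOne_of_le (by omega), insertOne_of_le (by omega),
      letterWeight_raise]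
  have e6 : ∀ i, letterWeight u₁ u₂ u₃ u₄ (insertOne w (a + 1) (a + 1 + 1 + 1 + i))
      (insertOne w (a + 1) (a + 1 + 1 + 1 + i + 1)) (insertOne w (a + 1) (a + 1 + 1 + 1 + i + 2)) =
      letterWeight u₁ u₂ u₃ u₄ (w (a + 1 + 1 + i)) (w (a + 1 + 1 + i + 1))
        (w (a + 1 + 1 + i + 2)) := fun i => by
    rw [show a + 1 + 1 + 1 + i = a + 1 + 1 + i + 1 by ring, insertOne_of_gt (by omega),
      insertOne_of_gt (by omega), insertOne_of_gt (by omega), letterWeight_raise]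
  have e7 : ∏ i ∈ Finset.range b, letterWeight u₁ u₂ u₃ u₄ (w (a + 1 + (i + 1)))
      (w (a + 1 + (i + 1) + 1)) (w (a + 1 + (i + 1) + 2)) =
      ∏ i ∈ Finset.range b, letterWeight u₁ u₂ u₃ u₄ (w (a + 1 + 1 + i))
        (w (a + 1 + 1 + i + 1)) (w (a + 1 + 1 + i + 2)) :=
    Finset.prod_congr rfl fun i _ => by rw [show a + 1 + (i + 1) = a + 1 + 1 + i by ring]
  rw [Finset.prod_congr rfl e5, Finset.prod_congr rfl fun i _ => e6 i, e7]
  simp only [add_zero, e0, e1, e2, e3, e4, f1, f2, f3, add_assoc, Nat.reduceAdd]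
  -- Only the smaller of the two neighbours of the new letter changes its type, so exactly one of
  -- the two summands is nonzero, and the weight of the larger neighbour is that of its old triple.
  rcases lt_or_gt_of_ne h with h | h
  · have g : letterWeight u₁ u₂ u₃ u₄ (w (a + 1)) (w (a + 2)) (w (a + 3)) =
        letterWeight u₁ u₂ u₃ u₄ 0 (w (a + 2)) (w (a + 3)) := by
      simp [letterWeight, h, h.not_gt, h₂]
    rw [rightPart, leftPart, if_pos h, if_neg h.not_gt, g]
    ring
  · have g : letterWeight u₁ u₂ u₃ u₄ (w a) (w (a + 1)) (w (a + 2)) =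
        letterWeight u₁ u₂ u₃ u₄ (w a) (w (a + 1)) 0 := by
      simp [letterWeight, h, h.not_gt, h₁]
    rw [rightPart, leftPart, if_neg h.not_gt, if_pos h, g]
    ring

lemma derivation_prod [Algebra ℚ A] (D : Derivation ℚ A A) {ι : Type*} [DecidableEq ι]
    (s : Finset ι) (f : ι → A) :
    D (∏ i ∈ s, f i) = ∑ i ∈ s, D (f i) * ∏ j ∈ s.erase i, f j := by
  induction s using Finset.induction_on with
  | empty => simp
  | insert a s ha ih =>
    rw [Finset.prod_insert ha, Derivation.leibniz, ih, Finset.sum_insert ha,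
      Finset.erase_insert ha, smul_eq_mul, smul_eq_mul, Finset.mul_sum, add_comm, mul_comm]
    congr 1
    refine Finset.sum_congr rfl fun i hi => ?_
    rw [Finset.erase_insert_of_ne (by rintro rfl; exact ha hi), Finset.prod_insert
      (fun h => ha (Finset.mem_of_mem_erase h))]
    ring

/-- Inserting a new smallest letter into all gaps of a word: the two outer gaps multiply the weight
by `u₄` and `u₃`, and the inner gaps together apply the derivation `D`. -/
lemma sum_wordWeight_insertOne [Algebra ℚ A] {D : Derivation ℚ A A} (h₁ : D u₁ = u₁ * (u₃ + u₄))
    (h₂ : D u₂ = 0) (h₃ : D u₃ = u₁ * u₂) (h₄ : D u₄ = u₁ * u₂) {w : ℕ → ℕ} {N : ℕ}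
    (hw₀ : w 0 = 0) (hw : ∀ i ≤ N, 0 < w (i + 1)) (hwN : w (N + 2) = 0)
    (hne : ∀ i ≤ N + 1, w i ≠ w (i + 1)) :
    ∑ a ∈ Finset.range N, wordWeight u₁ u₂ u₃ u₄ (insertOne w (a + 1)) (N + 2) =
      D (wordWeight u₁ u₂ u₃ u₄ w (N + 1)) := by
  set F : ℕ → A := fun i => letterWeight u₁ u₂ u₃ u₄ (w i) (w (i + 1)) (w (i + 2)) with hF
  have hD : ∀ i ∈ Finset.range (N + 1), D (F i) * ∏ j ∈ (Finset.range (N + 1)).erase i, F j =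
      rightPart u₁ u₂ u₃ u₄ (w i) (w (i + 1)) (w (i + 2)) *
          ∏ j ∈ (Finset.range (N + 1)).erase i, F j +
        leftPart u₁ u₂ u₃ u₄ (w i) (w (i + 1)) (w (i + 2)) *
          ∏ j ∈ (Finset.range (N + 1)).erase i, F j := fun i hi => by
    have := Finset.mem_range.1 hi
    rw [hF, derivation_letterWeight h₁ h₂ h₃ h₄ (hw i (by omega)) (hne i (by omega))
      (hne (i + 1) (by omega)), add_mul]
  rw [wordWeight, derivation_prod, Finset.sum_congr rfl hD, Finset.sum_add_distrib,
    Finset.sum_range_succ, Finset.sum_range_succ' _ N]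
  -- The last letter is followed, and the first preceded, by the padding `0`, which is smaller.
  have r0 : rightPart u₁ u₂ u₃ u₄ (w N) (w (N + 1)) (w (N + 2)) = 0 := by
    rw [rightPart, if_neg (by omega)]
  have l0 : leftPart u₁ u₂ u₃ u₄ (w 0) (w (0 + 1)) (w (0 + 2)) = 0 := by
    rw [leftPart, if_neg (by omega)]
  rw [r0, l0, zero_mul, zero_mul, add_zero, add_zero, ← Finset.sum_add_distrib]
  refine Finset.sum_congr rfl fun a ha => ?_
  obtain ⟨b, rfl⟩ := Nat.exists_eq_add_of_lt (Finset.mem_range.1 ha)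
  have e : a + b + 1 + 1 = a + 1 + 1 + b := by ring
  rw [show a + b + 1 + 2 = a + 1 + 1 + b + 1 by ring, e]
  exact wordWeight_insertOne_interior (hw a (by omega)) (hw (a + 1) (by omega))
    (hne (a + 1) (by omega))

end Words

/-! ### Inserting a new smallest letter into a permutation -/

section Permutations

open Equiv

lemma word_zero {N : ℕ} (σ : Perm (Fin N)) : word σ 0 = 0 := by
  simp [word]

lemma word_of_gt {N i : ℕ} (σ : Perm (Fin N)) (h : N < i) : word σ i = 0 := by
  rw [word, dif_neg (by omega)]

lemma word_succ {N : ℕ} (σ : Perm (Fin N)) (i : Fin N) : word σ (i + 1) = σ i + 1 := by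
  rw [word, dif_pos (by omega)]
  rfl

lemma word_succ_pos {N : ℕ} (σ : Perm (Fin N)) {i : ℕ} (h : i < N) : 0 < word σ (i + 1) := by
  rw [word_succ σ ⟨i, h⟩]
  omega

lemma word_ne_word_succ {N : ℕ} (σ : Perm (Fin (N + 1))) {i : ℕ} (h : i ≤ N + 1) :
    word σ i ≠ word σ (i + 1) := by
  rcases i with _ | i
  · rw [word_zero]
    exact (word_succ_pos σ (Nat.succ_pos N)).ne
  rcases h.lt_or_eq with h | h
  · rw [word_succ σ ⟨i, by omega⟩, word_succ σ ⟨i + 1, h⟩, Ne, Nat.add_right_cancel_iff, Fin.val_inj,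
      σ.injective.eq_iff, Fin.mk.injEq]
    omega
  · rw [word_of_gt σ (show N + 1 < i + 1 + 1 by omega)]
    exact (word_succ_pos σ (by omega)).ne'

/-- The permutation whose word arises from that of `τ` by raising all letters by one and inserting a
new smallest letter at position `p`. -/
def insertMin {N : ℕ} (p : Fin (N + 1)) (τ : Perm (Fin N)) : Perm (Fin (N + 1)) :=
  (finSuccEquiv' p).trans ((optionCongr τ).trans (finSuccEquiv' 0).symm)

variable {N : ℕ} (p : Fin (N + 1)) (τ : Perm (Fin N))

@[simp] lemma insertMin_self : insertMin p τ p = 0 := by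
  simp [insertMin]

@[simp] lemma insertMin_succAbove (j : Fin N) : insertMin p τ (p.succAbove j) = (τ j).succ := by
  simp [insertMin]

/-- Every permutation arises from exactly one insertion: the position of its smallest letter and the
remaining letters are determined. -/
lemma insertMin_bijective :
    Function.Bijective fun x : Fin (N + 1) × Perm (Fin N) => insertMin x.1 x.2 := by
  rw [Fintype.bijective_iff_injective_and_card]
  refine ⟨?_, by simp [Fintype.card_perm, Nat.factorial_succ]⟩
  rintro ⟨p, τ⟩ ⟨q, ρ⟩ h
  have hp : p = q := by
    apply (insertMin p τ).injective
    rw [insertMin_self]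
    simp only at h
    rw [h, insertMin_self]
  subst hp
  congr 1
  ext j : 1
  apply Fin.succ_injective
  rw [← insertMin_succAbove p, ← insertMin_succAbove p]
  simp only at h
  rw [h]

lemma word_insertMin (i : ℕ) : word (insertMin p τ) i = insertOne (word τ) p i := by
  rcases i with _ | i
  · rw [insertOne_of_le (Nat.zero_le _), word_zero, word_zero]
    rfl
  by_cases hi : N + 1 ≤ i
  · rw [word_of_gt _ (by omega), insertOne_of_gt (by omega), word_of_gt _ (by omega)]
    rfl
  have hw := word_succ (insertMin p τ) ⟨i, by omega⟩
  simp only at hw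
  rw [hw]
  by_cases hp : i = p
  · subst hp
    simp [insertOne_self]
  obtain ⟨j, hj⟩ := Fin.exists_succAbove_eq (x := ⟨i, by omega⟩) (y := p)
    (fun h => hp (congrArg Fin.val h))
  rw [← hj, insertMin_succAbove, Fin.val_succ, ← word_succ]
  have hr : word τ (j + 1) + 1 = raise (word τ (j + 1)) := by
    rw [raise, if_neg (word_succ_pos τ j.2).ne']
  rw [hr]
  rcases lt_or_ge j.castSucc p with h | h
  · rw [Fin.succAbove_of_castSucc_lt _ _ h] at hj
    have hji : (j : ℕ) = i := congrArg Fin.val hj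
    have : (j : ℕ) < p := h
    rw [insertOne_of_le (by omega), hji]
  · rw [Fin.succAbove_of_le_castSucc _ _ h] at hj
    have hji : (j : ℕ) + 1 = i := congrArg Fin.val hj
    have : (p : ℕ) ≤ j := h
    rw [insertOne_of_gt (by omega), hji]

lemma lrMax_insertMin : lrMax (insertMin p τ) = lrMax τ + if p = 0 then 1 else 0 := by
  rw [lrMax, lrMax, Finset.card_filter, Finset.card_filter, Fin.sum_univ_succAbove _ p, add_comm]
  congr 1
  · refine Finset.sum_congr rfl fun i _ => ?_
    congr 1
    simp [Fin.forall_iff_succAbove p]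
  · congr 1
    simp only [insertMin_self, Fin.not_lt_zero, imp_false, not_lt, eq_iff_iff]
    exact ⟨fun h => le_antisymm (h 0) (Fin.zero_le _), fun h => h ▸ fun j => Fin.zero_le _⟩

lemma rlMax_insertMin : rlMax (insertMin p τ) = rlMax τ + if p = Fin.last N then 1 else 0 := by
  rw [rlMax, rlMax, Finset.card_filter, Finset.card_filter, Fin.sum_univ_succAbove _ p, add_comm]
  congr 1
  · refine Finset.sum_congr rfl fun i _ => ?_
    congr 1
    simp [Fin.forall_iff_succAbove p]
  · congr 1
    simp only [insertMin_self, Fin.not_lt_zero, imp_false, not_lt, eq_iff_iff]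
    exact ⟨fun h => le_antisymm (Fin.le_last _) (h _), fun h => h ▸ fun j => Fin.le_last _⟩

/-! ### The weight of a permutation -/

lemma one_le_lrMax (σ : Perm (Fin (N + 1))) : 1 ≤ lrMax σ := by
  refine Finset.card_pos.2 ⟨σ.symm (Fin.last N), ?_⟩
  simp only [Finset.mem_filter, Finset.mem_univ, true_and, apply_symm_apply]
  refine fun j hj => Fin.lt_last_iff_ne_last.2 fun h => hj.ne ?_
  rw [← h, symm_apply_apply]

lemma one_le_rlMax (σ : Perm (Fin (N + 1))) : 1 ≤ rlMax σ := by
  refine Finset.card_pos.2 ⟨σ.symm (Fin.last N), ?_⟩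
  simp only [Finset.mem_filter, Finset.mem_univ, true_and, apply_symm_apply]
  refine fun j hj => Fin.lt_last_iff_ne_last.2 fun h => hj.ne' ?_
  rw [← h, symm_apply_apply]

lemma word_le (σ : Perm (Fin N)) (i : ℕ) : word σ i ≤ N := by
  rw [word]
  split_ifs <;> omega

lemma one_le_exteriorPeaks (σ : Perm (Fin (N + 1))) : 1 ≤ exteriorPeaks σ := by
  -- The largest letter is an exterior peak.
  set i := σ.symm (Fin.last N) with hi
  have h : word σ (i + 1) = N + 1 := by
    rw [word_succ, hi, apply_symm_apply, Fin.val_last]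
  refine Finset.card_pos.2 ⟨i + 1, ?_⟩
  have h₁ := word_ne_word_succ σ (i := i) (by omega)
  have h₂ := word_ne_word_succ σ (i := i + 1) (by omega)
  have h₃ := word_le σ i
  have h₄ := word_le σ (i + 1 + 1)
  simp only [Finset.mem_filter, Finset.mem_Icc, Nat.add_sub_cancel]
  omega

section Weight

variable {A : Type*} [CommRing A] (u₁ u₂ u₃ u₄ α β : A)

lemma wordWeight_word (σ : Perm (Fin N)) :
    wordWeight u₁ u₂ u₃ u₄ (word σ) N =
      u₁ ^ valleys σ * u₂ ^ exteriorPeaks σ * u₃ ^ rightDoubleDescents σ *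
        u₄ ^ leftDoubleAscents σ := by
  have hrdd : rightDoubleDescents σ = ((Finset.Icc 1 N).filter fun i =>
      word σ (i - 1) > word σ i ∧ word σ i > word σ (i + 1)).card := by
    rw [rightDoubleDescents]
    congr 1
    ext i
    simp only [Finset.mem_filter, Finset.mem_Ioc, Finset.mem_Icc]
    refine ⟨fun h => ⟨by omega, h.2⟩, fun h => ⟨⟨?_, h.1.2⟩, h.2⟩⟩
    refine lt_of_le_of_ne h.1.1 ?_
    rintro rfl
    have := h.2.1
    simp [word_zero] at this
  have hlda : leftDoubleAscents σ = ((Finset.Icc 1 N).filter fun i =>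
      word σ (i - 1) < word σ i ∧ word σ i < word σ (i + 1)).card := by
    rw [leftDoubleAscents]
    congr 1
    ext i
    simp only [Finset.mem_filter, Finset.mem_Ico, Finset.mem_Icc]
    refine ⟨fun h => ⟨by omega, h.2⟩, fun h => ⟨⟨h.1.1, ?_⟩, h.2⟩⟩
    refine lt_of_le_of_ne h.1.2 ?_
    rintro rfl
    have := h.2.2
    simp [word_of_gt σ (Nat.lt_succ_self _)] at this
  have key : wordWeight u₁ u₂ u₃ u₄ (word σ) N = ∏ i ∈ Finset.Icc 1 N,
      letterWeight u₁ u₂ u₃ u₄ (word σ (i - 1)) (word σ i) (word σ (i + 1)) := by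
    rw [← Finset.Ico_add_one_right_eq_Icc, Finset.prod_Ico_eq_prod_range, wordWeight]
    refine Finset.prod_congr rfl fun i _ => ?_
    rw [Nat.add_sub_cancel_left, add_comm 1 i]
  rw [key, hrdd, hlda, valleys, exteriorPeaks]
  simp only [letterWeight, Finset.prod_mul_distrib, Finset.prod_ite, Finset.prod_const,
    one_pow, mul_one]

/-- The monomial of a permutation in which, unlike in `P`, peaks, left-to-right maxima and
right-to-left maxima are all counted. -/
def permWeight (σ : Perm (Fin N)) : A :=
  wordWeight u₁ u₂ u₃ u₄ (word σ) N * α ^ lrMax σ * β ^ rlMax σ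

lemma sum_permWeight (n : ℕ) :
    ∑ σ : Perm (Fin (n + 1)), permWeight u₁ u₂ u₃ u₄ α β σ =
      u₂ * α * β * P n u₁ u₂ u₃ u₄ α β := by
  rw [P, Finset.mul_sum]
  refine Finset.sum_congr rfl fun σ _ => ?_
  obtain ⟨a, ha⟩ := Nat.exists_eq_add_of_le' (one_le_lrMax σ)
  obtain ⟨b, hb⟩ := Nat.exists_eq_add_of_le' (one_le_rlMax σ)
  obtain ⟨c, hc⟩ := Nat.exists_eq_add_of_le' (one_le_exteriorPeaks σ)
  rw [permWeight, wordWeight_word, ha, hb, hc]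
  simp only [Nat.add_sub_cancel]
  ring

variable {u₁ u₂ u₃ u₄ α β}

lemma P_zero : P 0 u₁ u₂ u₃ u₄ α β = 1 := by
  have h₁ : valleys (1 : Perm (Fin 1)) = 0 := by decide
  have h₂ : exteriorPeaks (1 : Perm (Fin 1)) = 1 := by decide
  have h₃ : rightDoubleDescents (1 : Perm (Fin 1)) = 0 := by decide
  have h₄ : leftDoubleAscents (1 : Perm (Fin 1)) = 0 := by decide
  have h₅ : lrMax (1 : Perm (Fin 1)) = 1 := by decide
  have h₆ : rlMax (1 : Perm (Fin 1)) = 1 := by decide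
  rw [P, Fintype.sum_eq_single (1 : Perm (Fin 1))
    fun σ hσ => (hσ (Subsingleton.elim (α := Perm (Fin 1)) _ _)).elim]
  simp [h₁, h₂, h₃, h₄, h₅, h₆]

variable [Algebra ℚ A] {D : Derivation ℚ A A}

lemma sum_permWeight_insertMin (h₁ : D u₁ = u₁ * (u₃ + u₄)) (h₂ : D u₂ = 0)
    (h₃ : D u₃ = u₁ * u₂) (h₄ : D u₄ = u₁ * u₂) (hα : D α = 0) (hβ : D β = 0)
    (τ : Perm (Fin (N + 1))) :
    ∑ p, permWeight u₁ u₂ u₃ u₄ α β (insertMin p τ) =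
      (α * u₄ + β * u₃) * permWeight u₁ u₂ u₃ u₄ α β τ +
        D (permWeight u₁ u₂ u₃ u₄ α β τ) := by
  have hD : D (permWeight u₁ u₂ u₃ u₄ α β τ) =
      D (wordWeight u₁ u₂ u₃ u₄ (word τ) (N + 1)) * α ^ lrMax τ * β ^ rlMax τ := by
    simp only [permWeight, Derivation.leibniz, Derivation.leibniz_pow, hα, hβ, smul_eq_mul]
    ring
  have hw : ∀ p : Fin (N + 2), word (insertMin p τ) = insertOne (word τ) p := fun p =>
    funext (word_insertMin p τ)
  have hlast : ∀ i : Fin N, i.castSucc.succ ≠ Fin.last (N + 1) := fun i => by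
    rw [Fin.succ_castSucc]; exact (Fin.castSucc_lt_last _).ne
  have h0 : (Fin.last (N + 1)) ≠ 0 := Fin.last_pos.ne'
  rw [hD, ← sum_wordWeight_insertOne h₁ h₂ h₃ h₄ (word_zero τ)
    (fun i hi => word_succ_pos τ (by omega)) (word_of_gt τ (by omega))
    (fun i hi => word_ne_word_succ τ hi), Finset.sum_range, Fin.sum_univ_succ,
    Fin.sum_univ_castSucc]
  simp only [permWeight, lrMax_insertMin, rlMax_insertMin, hw, Fin.succ_ne_zero, if_false,
    hlast, Fin.succ_last, h0, h0.symm, if_true, add_zero, Fin.val_zero, Fin.val_last, Fin.val_succ,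
    Fin.val_castSucc, Finset.sum_mul]
  rw [wordWeight_insertOne_zero (word_zero τ) (word_succ_pos τ (Nat.succ_pos N)),
    wordWeight_insertOne_last (word_of_gt τ (by omega)) (word_succ_pos τ (Nat.lt_succ_self N))]
  ring

/-- The recurrence for `P`, multiplied by the monomial `u₂ α β`. -/
lemma mul_P_succ (h₁ : D u₁ = u₁ * (u₃ + u₄)) (h₂ : D u₂ = 0)
    (h₃ : D u₃ = u₁ * u₂) (h₄ : D u₄ = u₁ * u₂) (hα : D α = 0) (hβ : D β = 0) (n : ℕ) :
    u₂ * α * β * P (n + 1) u₁ u₂ u₃ u₄ α β =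
      u₂ * α * β * ((α * u₄ + β * u₃) * P n u₁ u₂ u₃ u₄ α β + D (P n u₁ u₂ u₃ u₄ α β)) := by
  have hD : D (u₂ * α * β * P n u₁ u₂ u₃ u₄ α β) = u₂ * α * β * D (P n u₁ u₂ u₃ u₄ α β) := by
    simp [Derivation.leibniz, h₂, hα, hβ]
  rw [← sum_permWeight, ← Function.Bijective.sum_comp insertMin_bijective, Fintype.sum_prod_type,
    Finset.sum_comm]
  simp only [sum_permWeight_insertMin h₁ h₂ h₃ h₄ hα hβ]
  rw [Finset.sum_add_distrib, ← Finset.mul_sum, ← map_sum, sum_permWeight, hD]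
  ring

end Weight
end Permutations

/-! ### The universal case and specialization -/

section Specialization

variable {A R : Type*} [CommRing A] [Algebra ℚ A] [CommRing R] [Algebra ℚ R]

lemma map_egf_P (φ : A →+* R) (u₁ u₂ u₃ u₄ α β : A) :
    PowerSeries.map φ (egf fun n => P n u₁ u₂ u₃ u₄ α β) =
      egf fun n => P n (φ u₁) (φ u₂) (φ u₃) (φ u₄) (φ α) (φ β) := by
  ext n
  simp [egf, P, RingHom.map_rat_algebraMap]

lemma map_expSeries (φ : A →+* R) (c : A) :
    PowerSeries.map φ (expSeries c) = expSeries (φ c) := by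
  ext n
  rw [coeff_map, coeff_expSeries, coeff_expSeries, map_mul, map_pow, RingHom.map_rat_algebraMap]

lemma map_base (φ : A →+* R) (u₁ u₂ u₃ u₄ : A) :
    PowerSeries.map φ (base u₁ u₂ u₃ u₄) = base (φ u₁) (φ u₂) (φ u₃) (φ u₄) := by
  ext n
  rw [coeff_map, base, base, map_sub, map_sub, map_sub, coeff_C_mul, coeff_C_mul, map_mul]
  simp only [coshSqrtSeries, sinhDivSqrtSeries, coeff_mk, apply_ite φ, map_zero, map_mul, map_pow,
    map_sub, map_add, map_ofNat, RingHom.map_rat_algebraMap]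

lemma map_seriesPow (φ : A →+* R) {f : A⟦X⟧} (hf : constantCoeff f = 1) (γ : A) :
    PowerSeries.map φ (seriesPow f γ) = seriesPow (PowerSeries.map φ f) (φ γ) := by
  have hs : HasSubst (f - 1) := HasSubst.of_constantCoeff_zero' (by simp [hf])
  have h₁ : PowerSeries.map φ (logOf f) = logOf (PowerSeries.map φ f) := by
    have h : PowerSeries.map φ (logOf f) =
        (PowerSeries.map φ (log A)).subst (PowerSeries.map φ (f - 1)) := map_subst hs (log A)
    rw [h, map_log, map_sub, map_one, logOf_eq]
  have h₂ : PowerSeries.map φ (seriesPow f γ) =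
      (PowerSeries.map φ (exp A)).subst (PowerSeries.map φ (C γ * logOf f)) :=
    map_subst (hasSubst_C_mul_logOf hf γ) (exp A)
  rw [h₂, map_exp, map_mul, map_C, h₁, seriesPow]

/-- In a polynomial ring over `ℚ` with the six parameters as variables, the recurrence determines a
derivation and `u₂ α β` can be cancelled. -/
lemma egf_P_universal :
    egf (fun n => P n (MvPolynomial.X 0 : MvPolynomial (Fin 6) ℚ) (.X 1) (.X 2) (.X 3) (.X 4)
      (.X 5)) = expSeries ((1 / 2 : ℚ) • ((.X 5 - .X 4) * (.X 2 - .X 3))) *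
      seriesPow (base (.X 0) (.X 1) (.X 2) (.X 3)) (-(.X 4 + .X 5)) := by
  let D : Derivation ℚ (MvPolynomial (Fin 6) ℚ) (MvPolynomial (Fin 6) ℚ) :=
    MvPolynomial.mkDerivation ℚ ![.X 0 * (.X 2 + .X 3), 0, .X 0 * .X 1, .X 0 * .X 1, 0, 0]
  have hD : ∀ i, D (.X i) =
      ![.X 0 * (.X 2 + .X 3), 0, .X 0 * .X 1, .X 0 * .X 1, 0, 0] i :=
    MvPolynomial.mkDerivation_X ℚ _
  refine egf_eq_of_recurrence D (hD 0) (hD 1) (hD 2) (hD 3) (hD 4) (hD 5) P_zero fun n => ?_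
  refine mul_left_cancel₀ ?_ (mul_P_succ (hD 0) (hD 1) (hD 2) (hD 3) (hD 4) (hD 5) n)
  simp [MvPolynomial.X_ne_zero]

/-- The identity in the form without square roots, at arbitrary elements of a `ℚ`-algebra. -/
theorem egf_P (u₁ u₂ u₃ u₄ α β : R) :
    egf (fun n => P n u₁ u₂ u₃ u₄ α β) =
      expSeries ((1 / 2 : ℚ) • ((β - α) * (u₃ - u₄))) *
        seriesPow (base u₁ u₂ u₃ u₄) (-(α + β)) := by
  let φ : MvPolynomial (Fin 6) ℚ →ₐ[ℚ] R := MvPolynomial.aeval ![u₁, u₂, u₃, u₄, α, β]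
  have hφ : ∀ i, φ (.X i) = ![u₁, u₂, u₃, u₄, α, β] i := MvPolynomial.aeval_X _
  have h := congrArg (PowerSeries.map (φ : MvPolynomial (Fin 6) ℚ →+* R)) egf_P_universal
  rw [map_mul, map_egf_P, map_expSeries, map_seriesPow _ (constantCoeff_base _ _ _ _),
    map_base] at h
  simpa [hφ] using h

end Specialization

end DescentStirling

theorem mainTheorem2 {R : Type*} [CommRing R] [Algebra ℚ R] (u₁ u₂ u₃ u₄ α β : R) :
    (∀ s : Rˣ, (s : R) ^ 2 = (u₃ + u₄) ^ 2 - 4 * u₁ * u₂ →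
      DescentStirling.egf (fun n => DescentStirling.P n u₁ u₂ u₃ u₄ α β) =
        DescentStirling.expSeries ((1 / 2 : ℚ) • ((β - α) * (u₃ - u₄))) *
          DescentStirling.seriesPow
            (DescentStirling.coshSeries ((1 / 2 : ℚ) • (s : R)) -
              PowerSeries.C ((u₃ + u₄) * ((s⁻¹ : Rˣ) : R)) *
                DescentStirling.sinhSeries ((1 / 2 : ℚ) • (s : R)))
            (-(α + β))) ∧
    DescentStirling.egf (fun n => DescentStirling.P n u₁ u₂ u₃ u₄ α β) =
      DescentStirling.expSeries ((1 / 2 : ℚ) • ((β - α) * (u₃ - u₄))) *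
        DescentStirling.seriesPow
          (DescentStirling.coshSqrtSeries ((u₃ + u₄) ^ 2 - 4 * u₁ * u₂) -
            PowerSeries.C (u₃ + u₄) *
              DescentStirling.sinhDivSqrtSeries ((u₃ + u₄) ^ 2 - 4 * u₁ * u₂))
          (-(α + β)) := by
  refine ⟨fun s hs => ?_, DescentStirling.egf_P u₁ u₂ u₃ u₄ α β⟩
  rw [DescentStirling.egf_P, DescentStirling.base, DescentStirling.coshSeries_half,
    DescentStirling.sinhSeries_half, hs, ← mul_assoc (C _), ← map_mul,
    Units.inv_mul_cancel_right]
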